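/- Let $d\ge 2$ be an integer and let $(e_n)_{n\ge 1}$ be a sequence of real numbers with $e_n\ge 1$ for all $n$. Write $\log$ for the logarithm to base $2$ and $[N]=\{1,\dots,N\}$. For $n\ge 1$ and a set $S\subset\mathbb{Z}^d$ with exactly $n^d$ elements, let $$F_n(S)=\min\{\operatorname{Lip}(f) : f\colon S\to [n]^d \text{ surjective}\},$$ where $\operatorname{Lip}(f)$ is the Lipschitz constant of $f$ with respect to the Euclidean distance. For a sequence $(c_n)_{n\ge1}$ of real numbers with $c_n\ge 1$, let $$\mathcal{G}_{(c_n)}=\prod_{n=1}^{\infty}\{S\subseteq [\lfloor c_n n\rfloor]^d : |S|=n^d\},$$ equipped with the product $\mathbb{P}$ of the uniform probability measures on its (finite) factors. Then there exists a sequence $(c_n)_{n\ge 1}$ of real numbers with $c_n\ge 1$ for all $n\ge 1$ and $$|c_n-e_n|\le \frac{2^{d+8}}{(\log n)^{1/d}}\qquad\text{for all } n\ge 2,$$ such that for every real number $\alpha>3$ a random sequence $(S_n)\in\mathcal{G}_{(c_n)}$ satisfies $$\mathbb{P}\Bigl[\limsup_{n\to\infty}F_n(S_n)(\log n)^{-\alpha/d}<\infty\Bigr]=1.$$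 -/

import Mathlib

open Filter MeasureTheory ProbabilityTheory

namespace Feige

/-- A lattice point `x ∈ ℤ^d`, viewed as a point of Euclidean space `ℝ^d`. -/
def toEuclidean {d : ℕ} (x : Fin d → ℤ) : EuclideanSpace ℝ (Fin d) :=
  WithLp.toLp 2 (fun i => (x i : ℝ))

/-- The finite cubic grid `{1, …, N}^d` of lattice points. -/
noncomputable def grid (d : ℕ) (N : ℤ) : Finset (Fin d → ℤ) :=
  Fintype.piFinset (fun _ : Fin d => Finset.Icc 1 N)

/-- The Lipschitz constant `Lip(f)` of a map between finite sets of lattice points, with respect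
to the Euclidean distance: the smallest `K ≥ 0` with `‖f x - f y‖₂ ≤ K * ‖x - y‖₂`. -/
noncomputable def lipConst {d : ℕ} {S T : Finset (Fin d → ℤ)} (f : S → T) : ℝ :=
  sInf {K : ℝ | 0 ≤ K ∧ ∀ x y : S,
    dist (toEuclidean (f x).1) (toEuclidean (f y).1) ≤
      K * dist (toEuclidean x.1) (toEuclidean y.1)}

/-- The Lipschitz constants of the surjective maps `S → {1, …, n}^d`. -/
def surjLipConsts (d n : ℕ) (S : Finset (Fin d → ℤ)) : Set ℝ :=
  {L : ℝ | ∃ f : S → grid d n, Function.Surjective f ∧ lipConst f = L}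

/-- `F_n(S)`, the minimal Lipschitz constant of a surjective map `S → {1, …, n}^d`. It is used
for sets `S` of exactly `n^d` lattice points; there the minimum exists (`feige_isLeast`). -/
noncomputable def feige (d n : ℕ) (S : Finset (Fin d → ℤ)) : ℝ :=
  sInf (surjLipConsts d n S)

theorem card_grid (d n : ℕ) : (grid d n).card = n ^ d := by
  simp [grid]

/-- For `|S| = n^d` the infimum in the definition of `F_n(S)` is a minimum. -/
theorem feige_isLeast {d n : ℕ} {S : Finset (Fin d → ℤ)} (hS : S.card = n ^ d) :
    IsLeast (surjLipConsts d n S) (feige d n S) := by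
  have hfin : (surjLipConsts d n S).Finite :=
    (Set.finite_range (fun f : S → grid d n => lipConst f)).subset
      (fun L ⟨f, _, hf⟩ => ⟨f, hf⟩)
  have hne : (surjLipConsts d n S).Nonempty :=
    let g : S ≃ grid d n := Finset.equivOfCardEq (hS.trans (card_grid d n).symm)
    ⟨lipConst g, g, g.surjective, rfl⟩
  exact ⟨hne.csInf_mem hfin, fun _ h => csInf_le hfin.bddBelow h⟩

/-- The finite set of all `k`-element subsets of the grid `{1, …, N}^d`. -/
def GridSubsets (d : ℕ) (N : ℤ) (k : ℕ) : Type :=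
  {S : Finset (Fin d → ℤ) // S ⊆ grid d N ∧ S.card = k}

/-- The σ-algebra of all subsets. -/
instance (d : ℕ) (N : ℤ) (k : ℕ) : MeasurableSpace (GridSubsets d N k) := ⊤

/-- The sequence space `𝒢_(c_n)`, the product over `n ≥ 1` of the sets of all `n^d`-element
subsets of `{1, …, ⌊c_n * n⌋}^d`. -/
abbrev SeqSpace (d : ℕ) (c : ℕ+ → ℝ) : Type :=
  ∀ n : ℕ+, GridSubsets d ⌊c n * (n : ℕ)⌋ ((n : ℕ) ^ d)

/-- The uniform probability measure on `𝒢_(c_n)`: the product of the uniform probability measures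
`A ↦ |A| / |X_n|` on the finite factors `X_n`. -/
noncomputable def uniformSeq (d : ℕ) (c : ℕ+ → ℝ) : Measure (SeqSpace d c) :=
  Measure.infinitePi (fun _ : ℕ+ => uniformOn Set.univ)

end Feige

/-! Round `e n` up so that the cube has side `m * 2 ^ K`, and halve it `K` times in each direction.
If `S` splits almost evenly at every cut, cut the target box `(0, n]^d` along the same binary tree,
each time in proportion to the numbers of points. Every cell then owns a box whose volume is its
number of points. Put `R = n / 2 ^ K`, the rescaled side of a final cell. The permitted relative
imbalance is inversely proportional to the side being cut, so each cut displaces a wall by `O(h *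
R)`, and all `K * d` cuts together by `O(R)` once `K * d * h ≤ 1 / 2` (`hasRegions_cell`). Any `A ⊆
S` thus dominates a region of volume at least `|A|` within `O(R)` of the rescaled `A`. This is
Hall's condition for a bijection onto the grid with displacement `O(R)`
(`exists_surjective_of_hasRegions`), so `F_n(S) = O(R)`.

The two halves of a cell are exchanged by a translation, and swapping paired points preserves the
uniform law on `k`-subsets. This gives exponential concentration (`card_filter_lt_abs_sub_le`), and
a union bound over all cells follows (`card_filter_not_isBalanced_le`). As `K ≤ log n`, take `h` of
order `1 / log n`. The union bound costs one logarithm and `1 / h ^ 2` two more, so final cells need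
about `log ^ 3 n` points and `R` is of order `(log n) ^ (3 / d)`. The failure probabilities are `O(1
/ n ^ 2)`, and Borel–Cantelli concludes. -/

/-! ### Concentration for random `k`-subsets by swapping pairs -/

/-- Swapping `y` and `φ y` permutes the `k`-subsets of `G` and changes only the factor of `y`, since
the pairs are disjoint. Averaged over the swap, this factor is at most `1`: if just one of the two
points lies in `S`, the average is `exp (-l ^ 2 / 2) * cosh l`. So the factors can be removed one by
one. -/
theorem sum_prod_swap_le {Ω : Type*} [DecidableEq Ω] (G : Finset Ω) (k : ℕ) (φ : Ω → Ω) (l : ℝ)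
    (J : Finset Ω) (hφ : Set.InjOn φ J) (hJ : ∀ x ∈ J, x ∈ G) (hJφ : ∀ x ∈ J, φ x ∈ G)
    (hdis : ∀ x ∈ J, ∀ y ∈ J, φ x ≠ y) :
    ∑ S ∈ G.powersetCard k, ∏ x ∈ J,
      Real.exp (l * ((if x ∈ S then 1 else 0) - (if φ x ∈ S then 1 else 0))
        - l ^ 2 / 2 * ((if x ∈ S then 1 else 0) + (if φ x ∈ S then 1 else 0)))
      ≤ (G.powersetCard k).card := by
  induction J using Finset.induction_on with
  | empty => simp
  | insert y J hy ih =>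
    have ih' := ih (hφ.mono (by simp)) (fun x hx => hJ x (by simp [hx]))
      (fun x hx => hJφ x (by simp [hx])) (fun x hx z hz => hdis x (by simp [hx]) z (by simp [hz]))
    refine le_trans ?_ ih'
    simp only [Finset.prod_insert hy]
    set F : Finset Ω → ℝ := fun S => ∏ x ∈ J,
      Real.exp (l * ((if x ∈ S then 1 else 0) - (if φ x ∈ S then 1 else 0))
        - l ^ 2 / 2 * ((if x ∈ S then 1 else 0) + (if φ x ∈ S then 1 else 0))) with hF
    set u : Finset Ω → ℝ := fun S =>
      Real.exp (l * ((if y ∈ S then 1 else 0) - (if φ y ∈ S then 1 else 0))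
        - l ^ 2 / 2 * ((if y ∈ S then 1 else 0) + (if φ y ∈ S then 1 else 0))) with hu
    change ∑ S ∈ G.powersetCard k, u S * F S ≤ ∑ S ∈ G.powersetCard k, F S
    let σ : Finset Ω → Finset Ω := fun S => S.map (Equiv.swap y (φ y)).toEmbedding
    have hmem : ∀ S x, x ∈ σ S ↔ Equiv.swap y (φ y) x ∈ S := by
      intro S x
      simp only [σ, Finset.mem_map_equiv, Equiv.symm_swap]
    have hyG := hJ y (by simp)
    have hφG := hJφ y (by simp)
    have hσG : ∀ S ∈ G.powersetCard k, σ S ∈ G.powersetCard k := by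
      intro S hS
      rw [Finset.mem_powersetCard] at hS ⊢
      refine ⟨fun x hx => ?_, by simp [σ, hS.2]⟩
      rw [hmem] at hx
      have := hS.1 hx
      by_cases h1 : x = y
      · exact h1 ▸ hyG
      by_cases h2 : x = φ y
      · exact h2 ▸ hφG
      rwa [Equiv.swap_apply_of_ne_of_ne h1 h2] at this
    have hσσ : ∀ S, σ (σ S) = S := by
      intro S
      ext x
      simp [hmem]
    have hFσ : ∀ S, F (σ S) = F S := by
      intro S
      simp only [hF]
      refine Finset.prod_congr rfl fun x hx => ?_
      have e1 : Equiv.swap y (φ y) x = x := by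
        refine Equiv.swap_apply_of_ne_of_ne ?_ ?_
        · rintro rfl; exact hy hx
        · exact (hdis y (by simp) x (by simp [hx])).symm
      have e2 : Equiv.swap y (φ y) (φ x) = φ x := by
        refine Equiv.swap_apply_of_ne_of_ne (hdis x (by simp [hx]) y (by simp)) ?_
        intro h
        have := hφ (by simp [hx]) (by simp) h
        exact hy (this ▸ hx)
      simp only [hmem, e1, e2]
    have hswap : ∑ S ∈ G.powersetCard k, u S * F S
        = ∑ S ∈ G.powersetCard k, u (σ S) * F S := by
      refine Finset.sum_nbij' σ σ hσG hσG (fun S _ => hσσ S) (fun S _ => hσσ S) fun S _ => ?_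
      rw [hσσ, hFσ]
    have huσ : ∀ S, u S + u (σ S) ≤ 2 := by
      intro S
      have hc := Real.cosh_le_exp_half_sq l
      have h1 : Real.exp (-(l ^ 2 / 2)) * (Real.exp l + Real.exp (-l)) ≤ 2 := by
        rw [Real.cosh_eq] at hc
        calc _ ≤ Real.exp (-(l ^ 2 / 2)) * (2 * Real.exp (l ^ 2 / 2)) := by
              gcongr
              linarith
          _ = 2 * (Real.exp (-(l ^ 2 / 2)) * Real.exp (l ^ 2 / 2)) := by ring
          _ = 2 := by rw [← Real.exp_add]; simp
      rw [mul_add, ← Real.exp_add, ← Real.exp_add] at h1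
      simp only [hu, hmem, Equiv.swap_apply_left, Equiv.swap_apply_right]
      by_cases a : y ∈ S <;> by_cases b : φ y ∈ S
      · simp only [a, b, if_true]
        have : Real.exp (l * (1 - 1) - l ^ 2 / 2 * (1 + 1)) ≤ 1 :=
          Real.exp_le_one_iff.2 (by nlinarith [sq_nonneg l])
        linarith
      · simp only [a, b, if_true, if_false]
        convert h1 using 3 <;> ring
      · simp only [a, b, if_true, if_false]
        rw [add_comm]
        convert h1 using 3 <;> ring
      · simp [a, b]
        norm_num
    have hF0 : ∀ S, 0 ≤ F S := fun S => Finset.prod_nonneg fun x _ => (Real.exp_pos _).le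
    have : 2 * ∑ S ∈ G.powersetCard k, u S * F S ≤ 2 * ∑ S ∈ G.powersetCard k, F S := by
      calc _ = ∑ S ∈ G.powersetCard k, (u S + u (σ S)) * F S := by
            rw [two_mul]
            nth_rewrite 2 [hswap]
            rw [← Finset.sum_add_distrib]
            exact Finset.sum_congr rfl fun S _ => by ring
        _ ≤ ∑ S ∈ G.powersetCard k, 2 * F S :=
            Finset.sum_le_sum fun S _ => mul_le_mul_of_nonneg_right (huσ S) (hF0 S)
        _ = _ := by rw [Finset.mul_sum]
    linarith

theorem exp_card_sub_eq_prod {Ω : Type*} [DecidableEq Ω] (φ : Ω → Ω) (l : ℝ) (J S : Finset Ω)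
    (hφ : Set.InjOn φ J) :
    Real.exp (l * (((S ∩ J).card : ℝ) - (S ∩ J.image φ).card)
        - l ^ 2 / 2 * (((S ∩ J).card : ℝ) + (S ∩ J.image φ).card)) =
      ∏ x ∈ J, Real.exp (l * ((if x ∈ S then 1 else 0) - (if φ x ∈ S then 1 else 0))
        - l ^ 2 / 2 * ((if x ∈ S then 1 else 0) + (if φ x ∈ S then 1 else 0))) := by
  have h1 : ((S ∩ J).card : ℝ) = ∑ x ∈ J, if x ∈ S then 1 else 0 := by
    rw [Finset.inter_comm, ← Finset.filter_mem_eq_inter, Finset.card_filter]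
    simp
  have h2 : ((S ∩ J.image φ).card : ℝ) = ∑ x ∈ J, if φ x ∈ S then 1 else 0 := by
    rw [Finset.inter_comm, ← Finset.filter_mem_eq_inter, Finset.card_filter,
      ← Finset.sum_image (f := fun y => if y ∈ S then (1 : ℝ) else 0) hφ]
    simp
  rw [← Real.exp_sum, h1, h2]
  congr 1
  rw [Finset.sum_sub_distrib, ← Finset.mul_sum, ← Finset.mul_sum, Finset.sum_sub_distrib,
    Finset.sum_add_distrib]

/-- Markov's inequality for the exponential moment above: on this event the exponent is at least `η
^ 2 / 2` times the number of points in both parts, hence at least `η ^ 2 * M / 4`. The choices `l =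
η` and `l = -η` serve the two signs of the difference. -/
theorem card_filter_lt_mul_sub_le {Ω : Type*} [DecidableEq Ω] (G : Finset Ω) (k : ℕ) (φ : Ω → Ω)
    (η M l : ℝ) (hl : l ^ 2 = η ^ 2)
    (J : Finset Ω) (hφ : Set.InjOn φ J) (hJ : ∀ x ∈ J, x ∈ G) (hJφ : ∀ x ∈ J, φ x ∈ G)
    (hdis : ∀ x ∈ J, ∀ y ∈ J, φ x ≠ y) :
    (((G.powersetCard k).filter fun S =>
      M / 2 ≤ ((S ∩ J).card : ℝ) + (S ∩ J.image φ).card ∧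
      η ^ 2 * (((S ∩ J).card : ℝ) + (S ∩ J.image φ).card) <
        l * (((S ∩ J).card : ℝ) - (S ∩ J.image φ).card)).card : ℝ)
      ≤ Real.exp (-(η ^ 2 * M / 4)) * (G.powersetCard k).card := by
  have h := sum_prod_swap_le G k φ l J hφ hJ hJφ hdis
  simp only [← exp_card_sub_eq_prod φ l J _ hφ] at h
  set P : Finset Ω → Prop := fun S => M / 2 ≤ ((S ∩ J).card : ℝ) + (S ∩ J.image φ).card ∧
      η ^ 2 * (((S ∩ J).card : ℝ) + (S ∩ J.image φ).card) <
        l * (((S ∩ J).card : ℝ) - (S ∩ J.image φ).card) with hP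
  have h2 : (((G.powersetCard k).filter P).card : ℝ) * Real.exp (η ^ 2 * M / 4) ≤
      (G.powersetCard k).card := by
    refine le_trans ?_ h
    rw [← nsmul_eq_mul, ← Finset.sum_const]
    refine le_trans (Finset.sum_le_sum fun S hS => ?_)
      (Finset.sum_le_sum_of_subset_of_nonneg (Finset.filter_subset P _)
        fun S _ _ => (Real.exp_pos _).le)
    obtain ⟨ha, hb⟩ := (Finset.mem_filter.1 hS).2
    refine Real.exp_le_exp.2 ?_
    rw [hl]
    nlinarith [mul_le_mul_of_nonneg_left ha (sq_nonneg η)]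
  rw [Real.exp_neg, inv_mul_eq_div, le_div_iff₀ (Real.exp_pos _)]
  exact h2

/-- Exponential concentration of the difference of the numbers of points that a random `k`-subset
of `G` has in two parts of equal size. -/
theorem card_filter_lt_abs_sub_le {Ω : Type*} [DecidableEq Ω] (G : Finset Ω) (k : ℕ) (φ : Ω → Ω)
    (η M : ℝ) (hη : 0 < η)
    (J : Finset Ω) (hφ : Set.InjOn φ J) (hJ : ∀ x ∈ J, x ∈ G) (hJφ : ∀ x ∈ J, φ x ∈ G)
    (hdis : ∀ x ∈ J, ∀ y ∈ J, φ x ≠ y) :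
    (((G.powersetCard k).filter fun S =>
      M / 2 ≤ ((S ∩ J).card : ℝ) + (S ∩ J.image φ).card ∧
      η * (((S ∩ J).card : ℝ) + (S ∩ J.image φ).card) <
        |((S ∩ J).card : ℝ) - (S ∩ J.image φ).card|).card : ℝ)
      ≤ 2 * Real.exp (-(η ^ 2 * M / 4)) * (G.powersetCard k).card := by
  have h1 := card_filter_lt_mul_sub_le G k φ η M η rfl J hφ hJ hJφ hdis
  have h2 := card_filter_lt_mul_sub_le G k φ η M (-η) (by ring) J hφ hJ hJφ hdis
  rw [two_mul, add_mul]
  refine le_trans ?_ (add_le_add h1 h2)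
  rw [← Nat.cast_add]
  refine Nat.cast_le.2 (le_trans (Finset.card_le_card ?_) (Finset.card_union_le _ _))
  intro S hS
  rw [Finset.mem_filter] at hS
  rw [Finset.mem_union, Finset.mem_filter, Finset.mem_filter]
  obtain ⟨hS, ha, hb⟩ := hS
  rcases lt_abs.1 hb with hb | hb
  · exact Or.inl ⟨hS, ha, by nlinarith [mul_lt_mul_of_pos_left hb hη]⟩
  · exact Or.inr ⟨hS, ha, by nlinarith [mul_lt_mul_of_pos_left hb hη]⟩

/-! ### Geometry of the cyclic halving -/

/-- The `i`-th side length of the cells after `t` cuts: the cube of side `m * 2 ^ K` is halved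
cyclically in the coordinate directions `0, 1, …, d - 1, 0, 1, …`. -/
def cellSide (d K m t : ℕ) (i : Fin d) : ℕ := m * 2 ^ (K - (t + (d - 1 - i)) / d)

/-- The cell with lower corner `p` after `t` cuts. -/
noncomputable def cell (d K m t : ℕ) (p : Fin d → ℤ) : Finset (Fin d → ℤ) :=
  Fintype.piFinset fun i => Finset.Ioc (p i) (p i + cellSide d K m t i)

/-- The translation between the two halves in the `t`-th cut. -/
def cutShift (d K m t : ℕ) [NeZero d] : Fin d → ℤ :=
  Pi.single (Fin.ofNat d t) (cellSide d K m (t + 1) (Fin.ofNat d t) : ℤ)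

/-- The lower corners of all cells after `t` cuts. -/
def corners (d K m : ℕ) [NeZero d] : ℕ → Finset (Fin d → ℤ)
  | 0 => {0}
  | t + 1 => corners d K m t ∪ (corners d K m t).image (· + cutShift d K m t)

theorem card_corners_le (d K m t : ℕ) [NeZero d] : (corners d K m t).card ≤ 2 ^ t := by
  induction t with
  | zero => simp [corners]
  | succ t ih =>
    calc _ ≤ (corners d K m t).card + ((corners d K m t).image (· + cutShift d K m t)).card :=
          Finset.card_union_le _ _
      _ ≤ 2 ^ t + 2 ^ t := add_le_add ih (Finset.card_image_le.trans ih)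
      _ = _ := by ring

/-- The quotient in `cellSide` counts the `s < t` with `s ≡ i` modulo `d`, that is, the cuts already
made in direction `i`. -/
theorem cellSide_zero (d K m : ℕ) (i : Fin d) : cellSide d K m 0 i = m * 2 ^ K := by
  have : (0 + (d - 1 - i.val)) / d = 0 := Nat.div_eq_of_lt (by have := i.2; omega)
  rw [cellSide, this, Nat.sub_zero]

theorem cellSide_mul (d K m : ℕ) (i : Fin d) : cellSide d K m (K * d) i = m := by
  have hi := i.2
  have : (K * d + (d - 1 - i.val)) / d = K := by
    rw [add_comm, Nat.add_mul_div_right _ _ (by omega), Nat.div_eq_of_lt (by omega), zero_add]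
  simp [cellSide, this]

theorem cellSide_ofNat (d K m t : ℕ) [NeZero d] :
    cellSide d K m t (Fin.ofNat d t) = m * 2 ^ (K - t / d) := by
  have hd : 0 < d := Nat.pos_of_neZero d
  have : (t + (d - 1 - t % d)) / d = t / d := by
    have h1 := Nat.div_add_mod t d
    have h2 := Nat.mod_lt t hd
    have : t + (d - 1 - t % d) = (d - 1) + d * (t / d) := by omega
    rw [this, Nat.add_mul_div_left _ _ hd, Nat.div_eq_of_lt (by omega), zero_add]
  simp [cellSide, this]

theorem cellSide_succ_ofNat (d K m t : ℕ) [NeZero d] :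
    cellSide d K m (t + 1) (Fin.ofNat d t) = m * 2 ^ (K - (t / d + 1)) := by
  have hd : 0 < d := Nat.pos_of_neZero d
  have : (t + 1 + (d - 1 - t % d)) / d = t / d + 1 := by
    have h1 := Nat.div_add_mod t d
    have h2 := Nat.mod_lt t hd
    have : t + 1 + (d - 1 - t % d) = d * (t / d + 1) := by
      rw [mul_add]; omega
    rw [this, Nat.mul_div_cancel_left _ hd]
  simp [cellSide, this]

theorem two_mul_cellSide_succ_ofNat {d K m t : ℕ} [NeZero d] (ht : t < K * d) :
    2 * cellSide d K m (t + 1) (Fin.ofNat d t) = cellSide d K m t (Fin.ofNat d t) := by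
  have : t / d < K := (Nat.div_lt_iff_lt_mul (Nat.pos_of_neZero d)).2 ht
  rw [cellSide_ofNat, cellSide_succ_ofNat, show K - t / d = K - (t / d + 1) + 1 by omega, pow_succ]
  ring

theorem cellSide_succ_of_ne {d K m t : ℕ} [NeZero d] {i : Fin d} (hi : i ≠ Fin.ofNat d t) :
    cellSide d K m (t + 1) i = cellSide d K m t i := by
  have hd : 0 < d := Nat.pos_of_neZero d
  have hid := i.2
  have hne : i.val ≠ t % d := fun h => hi (Fin.ext h)
  have : (t + 1 + (d - 1 - i.val)) / d = (t + (d - 1 - i.val)) / d := by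
    rw [show t + 1 + (d - 1 - i.val) = t + (d - 1 - i.val) + 1 by ring, Nat.succ_div, if_neg]
    · rfl
    -- The quotient would grow only if `d` divided `t + 1 + (d - 1 - i)`, which forces `i = t % d`.
    rintro ⟨q, hq⟩
    have h1 := Nat.div_add_mod t d
    have h2 := Nat.mod_lt t hd
    have h3 : d * q = d * (t / d) + (t % d + d - i.val) := by omega
    have h4 : d * (q - t / d) = t % d + d - i.val := by
      rw [Nat.mul_sub]; omega
    have h5 : q - t / d = 1 := by
      have hlt : d * (q - t / d) < d * 2 := by omega
      have hpos : 0 < d * (q - t / d) := by omega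
      have := Nat.lt_of_mul_lt_mul_left hlt
      have := Nat.pos_of_mul_pos_left hpos
      omega
    rw [h5] at h4
    omega
  simp [cellSide, this]

theorem mem_cell {d K m t : ℕ} {p x : Fin d → ℤ} :
    x ∈ cell d K m t p ↔ ∀ i, p i < x i ∧ x i ≤ p i + cellSide d K m t i := by
  simp [cell]

theorem cutShift_ofNat (d K m t : ℕ) [NeZero d] :
    cutShift d K m t (Fin.ofNat d t) = cellSide d K m (t + 1) (Fin.ofNat d t) := by
  simp [cutShift]

theorem cutShift_of_ne {d K m t : ℕ} [NeZero d] {i : Fin d} (hi : i ≠ Fin.ofNat d t) :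
    cutShift d K m t i = 0 := by
  rw [cutShift, Pi.single_eq_of_ne hi]

theorem mem_cell_succ {d K m t : ℕ} [NeZero d] (ht : t < K * d) {p x : Fin d → ℤ} :
    x ∈ cell d K m (t + 1) p ↔ x ∈ cell d K m t p ∧
      x (Fin.ofNat d t) ≤ p (Fin.ofNat d t) + cellSide d K m (t + 1) (Fin.ofNat d t) := by
  simp only [mem_cell]
  have h2 := two_mul_cellSide_succ_ofNat (m := m) ht
  constructor
  · intro h
    refine ⟨fun i => ?_, (h _).2⟩
    by_cases hi : i = Fin.ofNat d t
    · subst hi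
      have := h (Fin.ofNat d t)
      omega
    · rw [← cellSide_succ_of_ne hi]; exact h i
  · rintro ⟨h, h'⟩ i
    by_cases hi : i = Fin.ofNat d t
    · subst hi
      exact ⟨(h _).1, h'⟩
    · rw [cellSide_succ_of_ne hi]; exact h i

theorem mem_cell_succ_add {d K m t : ℕ} [NeZero d] (ht : t < K * d) {p x : Fin d → ℤ} :
    x ∈ cell d K m (t + 1) (p + cutShift d K m t) ↔ x ∈ cell d K m t p ∧
      p (Fin.ofNat d t) + cellSide d K m (t + 1) (Fin.ofNat d t) < x (Fin.ofNat d t) := by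
  simp only [mem_cell, Pi.add_apply]
  have h2 := two_mul_cellSide_succ_ofNat (m := m) ht
  constructor
  · intro h
    refine ⟨fun i => ?_, by rw [← cutShift_ofNat]; exact (h _).1⟩
    by_cases hi : i = Fin.ofNat d t
    · subst hi
      have := h (Fin.ofNat d t)
      rw [cutShift_ofNat] at this
      omega
    · rw [← cellSide_succ_of_ne hi]
      have := h i
      rwa [cutShift_of_ne hi, add_zero] at this
  · rintro ⟨h, h'⟩ i
    by_cases hi : i = Fin.ofNat d t
    · subst hi
      rw [cutShift_ofNat]
      have := h (Fin.ofNat d t)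
      omega
    · rw [cellSide_succ_of_ne hi, cutShift_of_ne hi, add_zero]; exact h i

theorem cell_succ_subset {d K m t : ℕ} [NeZero d] (ht : t < K * d) (p : Fin d → ℤ) :
    cell d K m (t + 1) p ⊆ cell d K m t p := fun _ hx => ((mem_cell_succ ht).1 hx).1

theorem cell_succ_add_subset {d K m t : ℕ} [NeZero d] (ht : t < K * d) (p : Fin d → ℤ) :
    cell d K m (t + 1) (p + cutShift d K m t) ⊆ cell d K m t p :=
  fun _ hx => ((mem_cell_succ_add ht).1 hx).1

theorem disjoint_cell_succ {d K m t : ℕ} [NeZero d] (ht : t < K * d) (p : Fin d → ℤ) :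
    Disjoint (cell d K m (t + 1) p) (cell d K m (t + 1) (p + cutShift d K m t)) := by
  rw [Finset.disjoint_left]
  intro x h1 h2
  exact absurd ((mem_cell_succ ht).1 h1).2 (not_le.2 ((mem_cell_succ_add ht).1 h2).2)

theorem cell_succ_union {d K m t : ℕ} [NeZero d] (ht : t < K * d) (p : Fin d → ℤ) :
    cell d K m (t + 1) p ∪ cell d K m (t + 1) (p + cutShift d K m t) = cell d K m t p := by
  ext x
  rw [Finset.mem_union, mem_cell_succ ht, mem_cell_succ_add ht, ← and_or_left,
    and_iff_left (le_or_gt _ _)]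

theorem card_inter_cell_succ_add {d K m t : ℕ} [NeZero d] (ht : t < K * d) (p : Fin d → ℤ)
    (S : Finset (Fin d → ℤ)) :
    (S ∩ cell d K m (t + 1) p).card + (S ∩ cell d K m (t + 1) (p + cutShift d K m t)).card =
      (S ∩ cell d K m t p).card := by
  rw [← cell_succ_union ht, Finset.inter_union_distrib_left, Finset.card_union_of_disjoint]
  exact (disjoint_cell_succ ht p).mono Finset.inter_subset_right Finset.inter_subset_right

theorem image_cell_add {d K m t : ℕ} (p v : Fin d → ℤ) :
    (cell d K m t p).image (· + v) = cell d K m t (p + v) := by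
  ext x
  simp only [Finset.mem_image, mem_cell]
  constructor
  · rintro ⟨y, hy, rfl⟩ i
    have := hy i
    simp only [Pi.add_apply]
    omega
  · intro h
    refine ⟨x - v, fun i => ?_, by simp⟩
    have := h i
    simp only [Pi.add_apply, Pi.sub_apply] at this ⊢
    omega

theorem cell_zero_zero (d K m : ℕ) : cell d K m 0 0 = Feige.grid d (m * 2 ^ K : ℕ) := by
  ext x
  simp only [mem_cell, cellSide_zero, Feige.grid, Fintype.mem_piFinset, Finset.mem_Icc,
    Pi.zero_apply, zero_add]
  rfl

theorem cell_subset_grid {d K m t : ℕ} [NeZero d] (ht : t ≤ K * d) {p : Fin d → ℤ}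
    (hp : p ∈ corners d K m t) : cell d K m t p ⊆ Feige.grid d (m * 2 ^ K : ℕ) := by
  induction t generalizing p with
  | zero =>
    obtain rfl : p = 0 := by simpa [corners] using hp
    rw [cell_zero_zero]
  | succ t ih =>
    rw [corners, Finset.mem_union, Finset.mem_image] at hp
    rcases hp with hp | ⟨q, hq, rfl⟩
    · exact (cell_succ_subset (by omega) p).trans (ih (by omega) hp)
    · exact (cell_succ_add_subset (by omega) q).trans (ih (by omega) hq)

/-! ### Boxes with volumes equal to point counts -/

/-- All cuts split the set `S` into nearly equal parts, unless the cell is sparse. -/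
def IsBalanced (d K m n : ℕ) [NeZero d] (h : ℝ) (S : Finset (Fin d → ℤ)) : Prop :=
  ∀ t < K * d, ∀ p ∈ corners d K m t,
    (n : ℝ) ^ d / 2 ^ t / 2 ≤ (S ∩ cell d K m t p).card →
    |((S ∩ cell d K m (t + 1) p).card : ℝ) -
        (S ∩ cell d K m (t + 1) (p + cutShift d K m t)).card| ≤
      h * 2 ^ (t / d) / 2 ^ K * (S ∩ cell d K m t p).card

theorem prod_update_sub {d : ℕ} (a b : Fin d → ℝ) (i : Fin d) (x : ℝ) :
    ∏ j, (Function.update b i x j - a j) = (x - a i) * ∏ j ∈ Finset.univ.erase i, (b j - a j) := by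
  rw [← Finset.mul_prod_erase Finset.univ _ (Finset.mem_univ i), Function.update_self]
  congr 1
  refine Finset.prod_congr rfl fun j hj => ?_
  rw [Function.update_of_ne (Finset.ne_of_mem_erase hj)]

theorem prod_sub_update {d : ℕ} (a b : Fin d → ℝ) (i : Fin d) (x : ℝ) :
    ∏ j, (b j - Function.update a i x j) = (b i - x) * ∏ j ∈ Finset.univ.erase i, (b j - a j) := by
  rw [← Finset.mul_prod_erase Finset.univ _ (Finset.mem_univ i), Function.update_self]
  congr 1
  refine Finset.prod_congr rfl fun j hj => ?_
  rw [Function.update_of_ne (Finset.ne_of_mem_erase hj)]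

/-- Every set of points of `S` in a cell dominates a region of at least the same volume, inside the
box assigned to the cell and close to the (rescaled) points. -/
def HasRegions {d : ℕ} (σ D : ℝ) (S : Finset (Fin d → ℤ)) (a b : Fin d → ℝ) : Prop :=
  ∀ A ⊆ S, ∃ W : Set (Fin d → ℝ), MeasurableSet W ∧
    W ⊆ Set.pi Set.univ (fun i => Set.Ioc (a i) (b i)) ∧ (A.card : ENNReal) ≤ volume W ∧
    ∀ w ∈ W, ∃ x ∈ A, ∀ i, |w i - σ * x i| ≤ D

/-- The two regions lie on opposite sides of the hyperplane at `x`; half-open boxes make them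
disjoint, so their volumes add. -/
theorem HasRegions.union {d : ℕ} {σ D : ℝ} {S S₁ S₂ : Finset (Fin d → ℤ)} {a b : Fin d → ℝ}
    {i : Fin d} {x : ℝ} (ha : a i ≤ x) (hb : x ≤ b i)
    (h₁ : HasRegions σ D S₁ a (Function.update b i x))
    (h₂ : HasRegions σ D S₂ (Function.update a i x) b) (hS : S ⊆ S₁ ∪ S₂) :
    HasRegions σ D S a b := by
  intro A hA
  obtain ⟨W₁, hm₁, hs₁, hv₁, hd₁⟩ := h₁ (A ∩ S₁) Finset.inter_subset_right
  obtain ⟨W₂, hm₂, hs₂, hv₂, hd₂⟩ := h₂ (A ∩ S₂) Finset.inter_subset_right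
  refine ⟨W₁ ∪ W₂, hm₁.union hm₂, Set.union_subset (hs₁.trans ?_) (hs₂.trans ?_), ?_, ?_⟩
  · refine Set.pi_mono fun j _ => Set.Ioc_subset_Ioc_right ?_
    by_cases hj : j = i
    · subst hj; simpa using hb
    · rw [Function.update_of_ne hj]
  · refine Set.pi_mono fun j _ => Set.Ioc_subset_Ioc_left ?_
    by_cases hj : j = i
    · subst hj; simpa using ha
    · rw [Function.update_of_ne hj]
  · have hdis : Disjoint W₁ W₂ := by
      rw [Set.disjoint_left]
      intro w h1 h2
      have e1 := (hs₁ h1 i (Set.mem_univ i)).2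
      have e2 := (hs₂ h2 i (Set.mem_univ i)).1
      simp only [Function.update_self] at e1 e2
      linarith
    rw [measure_union hdis hm₂]
    refine le_trans ?_ (add_le_add hv₁ hv₂)
    rw [← Nat.cast_add, Nat.cast_le]
    refine le_trans (Finset.card_le_card ?_) (Finset.card_union_le _ _)
    intro y hy
    rcases Finset.mem_union.1 (hS (hA hy)) with h | h
    · exact Finset.mem_union_left _ (Finset.mem_inter.2 ⟨hy, h⟩)
    · exact Finset.mem_union_right _ (Finset.mem_inter.2 ⟨hy, h⟩)
  · rintro w (hw | hw)
    · obtain ⟨y, hy, h⟩ := hd₁ w hw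
      exact ⟨y, (Finset.mem_inter.1 hy).1, h⟩
    · obtain ⟨y, hy, h⟩ := hd₂ w hw
      exact ⟨y, (Finset.mem_inter.1 hy).1, h⟩

/-- The error of the new cut point, relative to the midpoint, when a box is cut in proportion to
the numbers `XL` and `XR` of points in the two halves. -/
theorem abs_cut_sub_le {a b A B E η XL XR : ℝ} (hX : 0 < XL + XR)
    (hη : |XL - XR| ≤ η * (XL + XR)) (hab : a ≤ b) (ha : |a - A| ≤ E) (hb : |b - B| ≤ E) :
    |a + XL / (XL + XR) * (b - a) - (A + B) / 2| ≤ E + η / 2 * (b - a) := by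
  have e : a + XL / (XL + XR) * (b - a) - (A + B) / 2 =
      ((a - A) + (b - B)) / 2 + (XL - XR) / (XL + XR) / 2 * (b - a) := by
    field_simp
    ring
  have h1 : |(XL - XR) / (XL + XR)| ≤ η := by
    rw [abs_div, abs_of_pos hX, div_le_iff₀ hX]
    exact hη
  rw [e]
  refine (abs_add_le _ _).trans (add_le_add ?_ ?_)
  · rw [abs_le] at ha hb ⊢
    constructor <;> linarith [ha.1, ha.2, hb.1, hb.2]
  · rw [abs_mul, abs_div, abs_two, abs_of_nonneg (sub_nonneg.2 hab)]
    gcongr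

theorem one_sub_mul_half_le {t h η M X : ℝ} (ht : 0 ≤ t) (h0 : 0 ≤ h) (hh : (t + 1) * h ≤ 1 / 2)
    (hη : η ≤ h) (hM : 0 ≤ M) (hX : 0 ≤ X) (hlow : (1 - t * h) * M ≤ X) :
    (1 - (t + 1) * h) * (M / 2) ≤ X * (1 - η) / 2 := by
  have hth := mul_nonneg ht h0
  have f1 : (1 - t * h) * M * (1 - h) ≤ X * (1 - η) :=
    mul_le_mul hlow (by linarith) (by linarith) hX
  have f2 : 0 ≤ t * h * h * M := by positivity
  nlinarith

/-- In a final cell any nonempty `A` may take the whole box, whose volume is `|S| ≥ |A|` and all of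
whose points are near every rescaled point of the cell. -/
theorem hasRegions_leaf {d : ℕ} {σ s D : ℝ} {S : Finset (Fin d → ℤ)}
    {a b : Fin d → ℝ} {p : Fin d → ℤ} (hab : ∀ i, a i ≤ b i)
    (hσ : 0 ≤ σ) (hS : ∀ x ∈ S, ∀ i, (p i : ℝ) ≤ x i ∧ (x i : ℝ) ≤ p i + s)
    (hvol : ∏ i, (b i - a i) = S.card)
    (ha : ∀ i, |a i - σ * p i| ≤ D) (hb : ∀ i, |b i - σ * (p i + s)| ≤ D) :
    HasRegions σ (D + σ * s) S a b := by
  intro A hA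
  rcases A.eq_empty_or_nonempty with rfl | ⟨x, hx⟩
  · exact ⟨∅, MeasurableSet.empty, Set.empty_subset _, by simp, by simp⟩
  refine ⟨_, MeasurableSet.univ_pi fun _ => measurableSet_Ioc, le_rfl, ?_, fun w hw => ?_⟩
  · rw [Real.volume_pi_Ioc, ← ENNReal.ofReal_prod_of_nonneg fun i _ => sub_nonneg.2 (hab i), hvol,
      ENNReal.ofReal_natCast, Nat.cast_le]
    exact Finset.card_le_card hA
  · refine ⟨x, hx, fun i => ?_⟩
    have hw' := hw i (Set.mem_univ i)
    have hx' := hS x (hA hx) i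
    have h1 := abs_le.1 (ha i)
    have h2 := abs_le.1 (hb i)
    have h3 := mul_le_mul_of_nonneg_left hx'.1 hσ
    have h4 := mul_le_mul_of_nonneg_left hx'.2 hσ
    rw [abs_le]
    constructor
    · nlinarith [hw'.1, hw'.2]
    · nlinarith [hw'.1, hw'.2]

set_option maxHeartbeats 1000000 in
-- Induction on the number `r` of remaining cuts. After `t` cuts the walls are off by at most `3 / 2
-- * t * h * R`, the volume equals the count, and the count is at least `1 - t * h` times its mean
-- scale `n ^ d / 2 ^ t`.
theorem hasRegions_cell {d K m n : ℕ} [NeZero d] {h : ℝ} {S : Finset (Fin d → ℤ)} (hm : 0 < m)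
    (hn : 0 < n) (h0 : 0 ≤ h) (hh : K * d * h ≤ 1 / 2) (hS : IsBalanced d K m n h S) (r : ℕ) :
    ∀ (t : ℕ) (_ : t + r = K * d) (p : Fin d → ℤ) (_ : p ∈ corners d K m t) (a b : Fin d → ℝ)
      (_ : ∀ i, |a i - n / (m * 2 ^ K) * p i| ≤ 3 / 2 * t * h * (n / 2 ^ K))
      (_ : ∀ i, |b i - n / (m * 2 ^ K) * (p i + cellSide d K m t i)| ≤ 3 / 2 * t * h * (n / 2 ^ K))
      (_ : ∀ i, a i ≤ b i) (_ : ∏ i, (b i - a i) = (S ∩ cell d K m t p).card)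
      (_ : (1 - t * h) * ((n : ℝ) ^ d / 2 ^ t) ≤ (S ∩ cell d K m t p).card),
      HasRegions (n / (m * 2 ^ K)) (2 * (n / 2 ^ K)) (S ∩ cell d K m t p) a b := by
  have hm' : (0 : ℝ) < m := Nat.cast_pos.2 hm
  have hn' : (0 : ℝ) < n := Nat.cast_pos.2 hn
  set R : ℝ := n / 2 ^ K with hR
  set σ : ℝ := n / (m * 2 ^ K) with hσ
  have hR0 : 0 < R := by positivity
  have hσ0 : 0 < σ := by positivity
  have hσm : σ * m = R := by rw [hσ, hR]; field_simp
  have hE : ∀ t : ℕ, t ≤ K * d → t * h ≤ 1 / 2 := fun t ht => by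
    refine le_trans ?_ hh
    gcongr
    exact_mod_cast ht
  induction r with
  | zero =>
    intro t ht p hp a b ha hb hab hvol hlow
    obtain rfl : t = K * d := by omega
    have hEt := hE _ le_rfl
    simp only [cellSide_mul] at hb
    have hle : 3 / 2 * ((K * d : ℕ) : ℝ) * h * R ≤ R := by
      nlinarith
    rw [show 2 * R = R + σ * m by rw [hσm, two_mul]]
    refine hasRegions_leaf (p := p) hab hσ0.le ?_ hvol (fun i => (ha i).trans hle)
      (fun i => (hb i).trans hle)
    intro x hx i
    have := mem_cell.1 (Finset.mem_inter.1 hx).2 i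
    rw [cellSide_mul] at this
    exact ⟨by exact_mod_cast this.1.le, by exact_mod_cast this.2⟩
  | succ r ih =>
    intro t ht p hp a b ha hb hab hvol hlow
    have htK : t < K * d := by omega
    have htd : t / d < K := (Nat.div_lt_iff_lt_mul (Nat.pos_of_neZero d)).2 htK
    have hEt := hE t htK.le
    set i := Fin.ofNat d t with hi
    set M : ℝ := (n : ℝ) ^ d / 2 ^ t with hM
    have hM0 : 0 < M := by positivity
    -- Since `t * h ≤ 1 / 2`, the cell is never sparse and balance applies to it.
    have hMhalf : M / 2 ≤ (S ∩ cell d K m t p).card := by nlinarith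
    have hcard : ((S ∩ cell d K m (t + 1) p).card : ℝ) +
        (S ∩ cell d K m (t + 1) (p + cutShift d K m t)).card = (S ∩ cell d K m t p).card := by
      exact_mod_cast card_inter_cell_succ_add htK p S
    have hbal := hS t htK p hp hMhalf
    rw [← hcard] at hbal hMhalf hvol hlow
    have hXL0 : (0 : ℝ) ≤ (S ∩ cell d K m (t + 1) p).card := Nat.cast_nonneg _
    have hXR0 : (0 : ℝ) ≤ (S ∩ cell d K m (t + 1) (p + cutShift d K m t)).card := Nat.cast_nonneg _
    obtain ⟨XL, hXL⟩ : ∃ y : ℝ, ((S ∩ cell d K m (t + 1) p).card : ℝ) = y := ⟨_, rfl⟩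
    obtain ⟨XR, hXR⟩ :
      ∃ y : ℝ, ((S ∩ cell d K m (t + 1) (p + cutShift d K m t)).card : ℝ) = y := ⟨_, rfl⟩
    rw [hXL, hXR] at hbal hMhalf hvol hlow
    rw [hXL] at hXL0
    rw [hXR] at hXR0
    have hX : 0 < XL + XR := by linarith
    set η : ℝ := h * 2 ^ (t / d) / 2 ^ K with hη
    have hη0 : 0 ≤ η := by positivity
    have hηh : η ≤ h := by
      rw [hη, mul_div_assoc]
      refine mul_le_of_le_one_right h0 ((div_le_one (by positivity)).2 ?_)
      exact pow_le_pow_right₀ (by norm_num) htd.le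
    set x : ℝ := a i + XL / (XL + XR) * (b i - a i) with hx
    have hq0 : 0 ≤ XL / (XL + XR) := by positivity
    have hq1 : XL / (XL + XR) ≤ 1 := (div_le_one hX).2 (by linarith)
    have hba : 0 ≤ b i - a i := sub_nonneg.2 (hab i)
    have hax : a i ≤ x := by
      rw [hx]; nlinarith [mul_nonneg hq0 hba]
    have hxb : x ≤ b i := by
      rw [hx]; nlinarith [mul_le_mul_of_nonneg_right hq1 hba]
    have hside : (cellSide d K m t i : ℝ) = 2 * cellSide d K m (t + 1) i := by
      exact_mod_cast (two_mul_cellSide_succ_ofNat (m := m) htK).symm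
    -- the scaled side length in the cut direction
    have hηs : η * (σ * cellSide d K m t i) = h * R := by
      rw [hi, cellSide_ofNat]
      push_cast
      rw [hη, ← hσm, show (2 : ℝ) ^ K = 2 ^ (K - t / d) * 2 ^ (t / d) by
        rw [← pow_add, Nat.sub_add_cancel htd.le]]
      field_simp
    have hRs : R ≤ σ * cellSide d K m t i := by
      rw [hi, cellSide_ofNat, ← hσm]
      push_cast
      gcongr
      exact le_mul_of_one_le_right hm'.le (one_le_pow₀ (by norm_num))
    -- Each wall is off by at most `R`, itself at most the scaled side; hence the factor `3`, and
    -- with `η / 2` the constant `3 / 2` of the induction.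
    have hlen : b i - a i ≤ 3 * (σ * cellSide d K m t i) := by
      have h1 := abs_le.1 (ha i)
      have h2 := abs_le.1 (hb i)
      have h3 : 3 / 2 * (t : ℝ) * h * R ≤ R := by nlinarith
      nlinarith [h1.1, h2.2]
    have hcut : |x - σ * (p i + cellSide d K m (t + 1) i)| ≤ 3 / 2 * (t + 1 : ℕ) * h * R := by
      have := abs_cut_sub_le hX hbal (hab i) (ha i) (hb i)
      rw [hside, show (σ * p i + σ * (p i + 2 * cellSide d K m (t + 1) i)) / 2 =
        σ * (p i + cellSide d K m (t + 1) i) by ring] at this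
      refine this.trans ?_
      have h1 : η / 2 * (b i - a i) ≤ 3 / 2 * h * R := by
        nlinarith [mul_le_mul_of_nonneg_left hlen hη0]
      push_cast
      linarith
    have hmono : 3 / 2 * (t : ℝ) * h * R ≤ 3 / 2 * ((t + 1 : ℕ) : ℝ) * h * R := by
      push_cast
      gcongr
      linarith
    have hsub : ∀ j, j ≠ i → cellSide d K m (t + 1) j = cellSide d K m t j :=
      fun j hj => cellSide_succ_of_ne hj
    have hlow' : ∀ Y : ℝ, (XL + XR) * (1 - η) / 2 ≤ Y →
        (1 - ((t + 1 : ℕ) : ℝ) * h) * ((n : ℝ) ^ d / 2 ^ (t + 1)) ≤ Y := by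
      intro Y hY
      refine le_trans ?_ hY
      have hh1 : ((t + 1 : ℕ) : ℝ) * h ≤ 1 / 2 := hE (t + 1) htK
      have e1 : (n : ℝ) ^ d / 2 ^ (t + 1) = M / 2 := by
        rw [hM, pow_succ]; field_simp
      rw [e1]
      push_cast at hh1 ⊢
      exact one_sub_mul_half_le (Nat.cast_nonneg t) h0 hh1 hηh hM0.le hX.le hlow
    have hb1 := abs_le.1 hbal
    have hshift : cutShift d K m t i = cellSide d K m (t + 1) i := cutShift_ofNat d K m t
    have hpL : p ∈ corners d K m (t + 1) := Finset.mem_union_left _ hp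
    have hpR : p + cutShift d K m t ∈ corners d K m (t + 1) :=
      Finset.mem_union_right _ (Finset.mem_image_of_mem _ hp)
    have hprod : (b i - a i) * ∏ j ∈ Finset.univ.erase i, (b j - a j) = XL + XR := by
      rw [← hvol, Finset.mul_prod_erase Finset.univ (fun j => b j - a j) (Finset.mem_univ i)]
    refine HasRegions.union hax hxb
      (ih (t + 1) (by omega) p hpL a (Function.update b i x) ?_ ?_ ?_ ?_ ?_)
      (ih (t + 1) (by omega) _ hpR (Function.update a i x) b ?_ ?_ ?_ ?_ ?_) ?_
    · exact fun j => (ha j).trans hmono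
    · intro j
      by_cases hj : j = i
      · subst hj; simpa using hcut
      · rw [Function.update_of_ne hj, hsub j hj]
        exact (hb j).trans hmono
    · intro j
      by_cases hj : j = i
      · subst hj; simpa using hax
      · rw [Function.update_of_ne hj]; exact hab j
    · rw [hXL, prod_update_sub, hx, add_sub_cancel_left, mul_assoc, hprod]
      field_simp
    · exact hlow' _ (by rw [hXL]; linarith [hb1.1])
    · intro j
      by_cases hj : j = i
      · rw [hj, Function.update_self, Pi.add_apply, hshift, Int.cast_add, Int.cast_natCast]
        exact hcut
      · rw [Function.update_of_ne hj, Pi.add_apply, cutShift_of_ne hj, add_zero]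
        exact (ha j).trans hmono
    · intro j
      by_cases hj : j = i
      · have := (hb i).trans hmono
        rw [hside, two_mul, ← add_assoc] at this
        rw [hj, Pi.add_apply, hshift, Int.cast_add, Int.cast_natCast]
        exact this
      · rw [Pi.add_apply, cutShift_of_ne hj, add_zero, hsub j hj]
        exact (hb j).trans hmono
    · intro j
      by_cases hj : j = i
      · subst hj; simpa using hxb
      · rw [Function.update_of_ne hj]; exact hab j
    · rw [hXR, prod_sub_update, show b i - x = XR / (XL + XR) * (b i - a i) by rw [hx]; field_simp; ring,
        mul_assoc, hprod]
      field_simp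
    · exact hlow' _ (by rw [hXR]; linarith [hb1.2])
    · rw [← Finset.inter_union_distrib_left, cell_succ_union htK]

/-! ### From regions to Lipschitz surjections -/

theorem abs_sub_le_dist_toEuclidean {d : ℕ} (x y : Fin d → ℤ) (i : Fin d) :
    |(x i : ℝ) - y i| ≤ dist (Feige.toEuclidean x) (Feige.toEuclidean y) := by
  rw [EuclideanSpace.dist_eq]
  refine Real.abs_le_sqrt ?_
  refine le_trans (le_of_eq ?_) (Finset.single_le_sum
    (f := fun i => dist ((Feige.toEuclidean x) i) ((Feige.toEuclidean y) i) ^ 2)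
    (fun _ _ => sq_nonneg _) (Finset.mem_univ i))
  simp [Feige.toEuclidean, Real.dist_eq]

theorem dist_toEuclidean_le {d : ℕ} (hd : 1 ≤ d) {x y : Fin d → ℤ} {B : ℝ} (hB : 0 ≤ B)
    (h : ∀ i, |(x i : ℝ) - y i| ≤ B) :
    dist (Feige.toEuclidean x) (Feige.toEuclidean y) ≤ d * B := by
  have hd' : (1 : ℝ) ≤ d := by exact_mod_cast hd
  rw [EuclideanSpace.dist_eq]
  refine Real.sqrt_le_iff.2 ⟨by positivity, ?_⟩
  calc _ ≤ ∑ _i : Fin d, B ^ 2 := by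
        refine Finset.sum_le_sum fun i _ => ?_
        have := h i
        simp only [Feige.toEuclidean, Real.dist_eq]
        gcongr
    _ = d * B ^ 2 := by simp
    _ ≤ (d * B) ^ 2 := by
        rw [mul_pow]
        gcongr
        nlinarith

theorem one_le_dist_toEuclidean {d : ℕ} {x y : Fin d → ℤ} (h : x ≠ y) :
    1 ≤ dist (Feige.toEuclidean x) (Feige.toEuclidean y) := by
  obtain ⟨i, hi⟩ := Function.ne_iff.1 h
  refine le_trans ?_ (abs_sub_le_dist_toEuclidean x y i)
  exact_mod_cast Int.one_le_abs (sub_ne_zero.2 hi)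

/-- A map that moves points by a bounded amount from their rescaled positions is Lipschitz. -/
theorem lipConst_le_of_abs_sub_le {d : ℕ} (hd : 1 ≤ d) {S T : Finset (Fin d → ℤ)} (f : S → T)
    {σ D : ℝ} (hσ0 : 0 ≤ σ) (hσ1 : σ ≤ 1) (hD : 0 ≤ D)
    (hf : ∀ (x : S) (i), |((f x).1 i : ℝ) - σ * x.1 i| ≤ D) :
    Feige.lipConst f ≤ d * (1 + 2 * D) := by
  refine csInf_le ⟨0, fun K hK => hK.1⟩ ⟨by positivity, fun x y => ?_⟩
  rcases eq_or_ne x y with rfl | hxy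
  · simp
  have h1 := one_le_dist_toEuclidean (fun h => hxy (Subtype.ext h) : x.1 ≠ y.1)
  rw [mul_assoc]
  refine dist_toEuclidean_le hd (by positivity) fun i => ?_
  have h2 := abs_sub_le_dist_toEuclidean x.1 y.1 i
  have e : ((f x).1 i : ℝ) - (f y).1 i =
      (((f x).1 i : ℝ) - σ * x.1 i) - (((f y).1 i : ℝ) - σ * y.1 i) +
        σ * ((x.1 i : ℝ) - y.1 i) := by ring
  have h3 : |σ * ((x.1 i : ℝ) - y.1 i)| ≤
      dist (Feige.toEuclidean x.1) (Feige.toEuclidean y.1) := by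
    rw [abs_mul, abs_of_nonneg hσ0]
    exact (mul_le_of_le_one_left (abs_nonneg _) hσ1).trans h2
  calc _ ≤ D + D + dist (Feige.toEuclidean x.1) (Feige.toEuclidean y.1) := by
        rw [e]
        exact (abs_add_le _ _).trans
          (add_le_add ((abs_sub _ _).trans (add_le_add (hf x i) (hf y i))) h3)
    _ ≤ _ := by nlinarith

/-- The volume of a region in `(0, n]^d` is at most the number of grid points near it. -/
theorem volume_le_card_grid_filter {d n : ℕ} {W : Set (Fin d → ℝ)}
    (hW : W ⊆ Set.pi Set.univ fun _ => Set.Ioc (0 : ℝ) n) (T : Finset (Fin d → ℤ))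
    (hT : ∀ y ∈ Feige.grid d n, (∃ w ∈ W, ∀ i, |(y i : ℝ) - w i| ≤ 1) → y ∈ T) :
    volume W ≤ T.card := by
  -- Rounding coordinates up sends `(0, n]` into `{1, …, n}`, so `W` is covered by unit cubes with
  -- upper corners in `T`.
  have hsub : W ⊆ ⋃ y ∈ T, Set.pi Set.univ fun i => Set.Ioc ((y i : ℝ) - 1) (y i) := by
    intro w hw
    have hc : ∀ i, (⌈w i⌉ : ℝ) - 1 < w i ∧ w i ≤ ⌈w i⌉ := fun i =>
      ⟨by linarith [Int.ceil_lt_add_one (w i)], Int.le_ceil _⟩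
    refine Set.mem_biUnion (x := fun i => ⌈w i⌉) (hT _ ?_ ⟨w, hw, fun i => ?_⟩) fun i _ => hc i
    · simp only [Feige.grid, Fintype.mem_piFinset, Finset.mem_Icc]
      intro i
      have := hW hw i (Set.mem_univ i)
      exact ⟨Int.one_le_ceil_iff.2 this.1, Int.ceil_le.2 (by exact_mod_cast this.2)⟩
    · have := hc i
      rw [abs_le]
      constructor <;> linarith [this.1, this.2]
  calc volume W ≤ ∑ y ∈ T, volume (Set.pi Set.univ fun i => Set.Ioc ((y i : ℝ) - 1) (y i)) :=
        (measure_mono hsub).trans (measure_biUnion_finset_le _ _)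
    _ = T.card := by simp [Real.volume_pi_Ioc]

/-- Hall's marriage theorem: the grid points within `1` of the region of `A` are neighbours of `A`
and number at least its volume. The resulting injection is onto because both sides have `n ^ d`
elements. -/
theorem exists_surjective_of_hasRegions {d n : ℕ} {σ D : ℝ} {S : Finset (Fin d → ℤ)}
    (hS : S.card = n ^ d) (h : HasRegions σ D S (fun _ => 0) fun _ => n) :
    ∃ f : S → Feige.grid d n, Function.Surjective f ∧
      ∀ (x : S) (i), |((f x).1 i : ℝ) - σ * x.1 i| ≤ D + 1 := by
  classical
  let N : S → Finset (Fin d → ℤ) := fun x =>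
    (Feige.grid d n).filter fun y => ∀ i, |(y i : ℝ) - σ * x.1 i| ≤ D + 1
  have hall : ∀ A : Finset S, A.card ≤ (A.biUnion N).card := by
    intro A
    obtain ⟨W, -, hW, hvol, hd⟩ := h (A.map (Function.Embedding.subtype _)) (by
      intro x hx
      obtain ⟨y, -, rfl⟩ := Finset.mem_map.1 hx
      exact y.2)
    rw [Finset.card_map] at hvol
    have := hvol.trans (volume_le_card_grid_filter hW (A.biUnion N) ?_)
    · exact_mod_cast this
    rintro y hy ⟨w, hw, hyw⟩
    obtain ⟨x, hx, hxw⟩ := hd w hw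
    obtain ⟨z, hz, rfl⟩ := Finset.mem_map.1 hx
    refine Finset.mem_biUnion.2 ⟨z, hz, Finset.mem_filter.2 ⟨hy, fun i => ?_⟩⟩
    have := abs_sub_le (y i : ℝ) (w i) (σ * z.1 i)
    have h1 := hyw i
    have h2 := hxw i
    simp only [Function.Embedding.subtype_apply] at h2
    linarith
  obtain ⟨f, hinj, hf⟩ := (Finset.all_card_le_biUnion_card_iff_exists_injective N).1 hall
  have hmem := fun x => Finset.mem_filter.1 (hf x)
  refine ⟨fun x => ⟨f x, (hmem x).1⟩, ?_, fun x => (hmem x).2⟩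
  have hinj' : Function.Injective fun x : S => (⟨f x, (hmem x).1⟩ : Feige.grid d n) :=
    fun x y hxy => hinj (congrArg Subtype.val hxy)
  refine ((Fintype.bijective_iff_injective_and_card _).2 ⟨hinj', ?_⟩).2
  rw [Fintype.card_coe, Fintype.card_coe, hS, Feige.card_grid]

theorem feige_le_of_isBalanced {d K m n : ℕ} [NeZero d] {h : ℝ} {S : Finset (Fin d → ℤ)}
    (hKn : 2 ^ K ≤ n) (hnm : n ≤ m * 2 ^ K) (h0 : 0 ≤ h)
    (hh : K * d * h ≤ 1 / 2) (hSG : S ⊆ Feige.grid d (m * 2 ^ K : ℕ)) (hcard : S.card = n ^ d)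
    (hS : IsBalanced d K m n h S) :
    Feige.feige d n S ≤ 7 * d * (n / 2 ^ K) := by
  have hd : 1 ≤ d := Nat.pos_of_neZero d
  have hn : 0 < n := lt_of_lt_of_le (by positivity) hKn
  have hm : 0 < m := Nat.pos_of_ne_zero (by rintro rfl; omega)
  have hm' : (0 : ℝ) < m := Nat.cast_pos.2 hm
  have hcell : S ∩ cell d K m 0 0 = S := by
    rw [cell_zero_zero]; exact Finset.inter_eq_left.2 hSG
  -- The rescaled cube is exactly `(0, n]^d`, so the induction starts with no error.
  have hreg := hasRegions_cell hm hn h0 hh hS (K * d) 0 (by omega) 0 (by simp [corners])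
    (fun _ => 0) (fun _ => n) (by simp)
    (by
      intro i
      rw [cellSide_zero]
      push_cast
      simp only [Pi.zero_apply, Int.cast_zero, zero_add]
      rw [div_mul_cancel₀ _ (by positivity)]
      simp)
    (by simp) (by rw [hcell, hcard]; simp) (by rw [hcell, hcard]; simp)
  rw [hcell] at hreg
  obtain ⟨f, hf, hfd⟩ := exists_surjective_of_hasRegions hcard hreg
  have hR1 : (1 : ℝ) ≤ n / 2 ^ K := by
    rw [le_div_iff₀ (by positivity), one_mul]; exact_mod_cast hKn
  have hσ1 : (n : ℝ) / (m * 2 ^ K) ≤ 1 := by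
    rw [div_le_one (by positivity)]; exact_mod_cast hnm
  calc _ ≤ Feige.lipConst f := (Feige.feige_isLeast hcard).2 ⟨f, hf, rfl⟩
    _ ≤ d * (1 + 2 * (2 * (n / 2 ^ K) + 1)) :=
        lipConst_le_of_abs_sub_le hd f (by positivity) hσ1 (by positivity) hfd
    -- `3 + 4 * R ≤ 7 * R`, because `R ≥ 1`.
    _ ≤ d * (7 * (n / 2 ^ K)) := by gcongr; linarith
    _ = _ := by ring

/-! ### Union bound over all cuts -/

/-- With `k = t / d`, the squared tolerance grows like `4 ^ k` while the mean count decays like `2 ^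
(-k * d)`. As `d ≥ 2`, the product is smallest for the finest cells, and the hypothesis bounds it
there. The `/ 2` inside the power absorbs `t ≤ (k + 1) * d`. -/
theorem le_sq_mul_of_le_mul_pow {d K t n : ℕ} {h τ : ℝ} (hd : 2 ≤ d) (ht : t < K * d)
    (hτ : 4 * τ ≤ h ^ 2 * ((n : ℝ) / 2 ^ K / 2) ^ d) :
    τ ≤ (h * 2 ^ (t / d) / 2 ^ K) ^ 2 * ((n : ℝ) ^ d / 2 ^ t) / 4 := by
  have htd : t / d < K := (Nat.div_lt_iff_lt_mul (by omega)).2 ht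
  have ht' : t ≤ (t / d + 1) * d := by
    rw [mul_comm]; exact (Nat.lt_mul_div_succ t (by omega)).le
  have h2t : (2 : ℝ) ^ t ≤ (2 ^ (t / d)) ^ d * 2 ^ d := by
    rw [← mul_pow, ← pow_succ, ← pow_mul]
    exact pow_le_pow_right₀ (by norm_num) ht'
  have hkK : (2 : ℝ) ^ (t / d) ≤ 2 ^ K := pow_le_pow_right₀ (by norm_num) htd.le
  obtain ⟨q, rfl⟩ : ∃ q, d = q + 2 := ⟨d - 2, by omega⟩
  set u : ℝ := 2 ^ (t / (q + 2)) with hu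
  set v : ℝ := 2 ^ K with hv
  have hu0 : 0 < u := by positivity
  have hv0 : 0 < v := by positivity
  rw [le_div_iff₀ (by norm_num), mul_comm]
  refine hτ.trans ?_
  calc h ^ 2 * ((n : ℝ) / v / 2) ^ (q + 2)
      = h ^ 2 / v ^ 2 * ((n : ℝ) ^ (q + 2) / (v ^ q * 2 ^ (q + 2))) := by
        rw [div_pow, div_pow]; field_simp; ring
    _ ≤ h ^ 2 / v ^ 2 * ((n : ℝ) ^ (q + 2) / (u ^ q * 2 ^ (q + 2))) := by gcongr
    _ = (h * u / v) ^ 2 * ((n : ℝ) ^ (q + 2) / (u ^ (q + 2) * 2 ^ (q + 2))) := by field_simp; ring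
    _ ≤ _ := by gcongr

theorem card_filter_not_isBalanced_le {d K m n : ℕ} [NeZero d] {h τ : ℝ} (hd : 2 ≤ d) (h0 : 0 < h)
    (k : ℕ)
    (hτ : 4 * τ ≤ h ^ 2 * ((n : ℝ) / 2 ^ K / 2) ^ d)
    [DecidablePred fun S => ¬ IsBalanced d K m n h S] :
    ((((Feige.grid d (m * 2 ^ K : ℕ)).powersetCard k).filter
      fun S => ¬ IsBalanced d K m n h S).card : ℝ) ≤
      2 * 2 ^ (K * d) * Real.exp (-τ) * ((Feige.grid d (m * 2 ^ K : ℕ)).powersetCard k).card := by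
  classical
  set G := Feige.grid d (m * 2 ^ K : ℕ) with hG
  let B : ℕ → (Fin d → ℤ) → Finset (Finset (Fin d → ℤ)) := fun t p =>
    (G.powersetCard k).filter fun S =>
      (n : ℝ) ^ d / 2 ^ t / 2 ≤ ((S ∩ cell d K m (t + 1) p).card : ℝ) +
        (S ∩ (cell d K m (t + 1) p).image (· + cutShift d K m t)).card ∧
      h * 2 ^ (t / d) / 2 ^ K * (((S ∩ cell d K m (t + 1) p).card : ℝ) +
        (S ∩ (cell d K m (t + 1) p).image (· + cutShift d K m t)).card) <
        |((S ∩ cell d K m (t + 1) p).card : ℝ) -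
          (S ∩ (cell d K m (t + 1) p).image (· + cutShift d K m t)).card|
  have hB : ∀ t < K * d, ∀ p ∈ corners d K m t,
      ((B t p).card : ℝ) ≤ 2 * Real.exp (-τ) * (G.powersetCard k).card := by
    intro t ht p hp
    have hsub := cell_subset_grid ht.le hp
    have him : ∀ x ∈ cell d K m (t + 1) p,
        x + cutShift d K m t ∈ cell d K m (t + 1) (p + cutShift d K m t) := fun x hx => by
      rw [← image_cell_add]; exact Finset.mem_image_of_mem _ hx
    refine (card_filter_lt_abs_sub_le G k (· + cutShift d K m t) (h * 2 ^ (t / d) / 2 ^ K)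
      ((n : ℝ) ^ d / 2 ^ t) (by positivity) (cell d K m (t + 1) p)
      (fun x _ y _ hxy => add_right_cancel hxy)
      (fun x hx => hsub (cell_succ_subset ht p hx))
      (fun x hx => hsub (cell_succ_add_subset ht p (him x hx)))
      (fun x hx y hy hxy => Finset.disjoint_left.1 (disjoint_cell_succ ht p) hy
        (hxy ▸ him x hx))).trans ?_
    gcongr
    exact le_sq_mul_of_le_mul_pow hd ht hτ
  have hcover : ((G.powersetCard k).filter fun S => ¬ IsBalanced d K m n h S) ⊆
      (Finset.range (K * d)).biUnion fun t => (corners d K m t).biUnion fun p => B t p := by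
    intro S hS
    obtain ⟨hS, hb⟩ := Finset.mem_filter.1 hS
    unfold IsBalanced at hb
    push Not at hb
    obtain ⟨t, ht, p, hp, h1, h2⟩ := hb
    refine Finset.mem_biUnion.2 ⟨t, Finset.mem_range.2 ht, Finset.mem_biUnion.2 ⟨p, hp,
      Finset.mem_filter.2 ⟨hS, ?_⟩⟩⟩
    rw [← card_inter_cell_succ_add ht, Nat.cast_add] at h1 h2
    rw [image_cell_add]
    exact ⟨h1, h2⟩
  have hcount : ((((G.powersetCard k).filter fun S => ¬ IsBalanced d K m n h S).card : ℕ) : ℝ) ≤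
      ∑ t ∈ Finset.range (K * d), ∑ p ∈ corners d K m t, ((B t p).card : ℝ) := by
    have := (Finset.card_le_card hcover).trans (Finset.card_biUnion_le.trans
      (Finset.sum_le_sum fun t _ => Finset.card_biUnion_le))
    exact_mod_cast this
  refine hcount.trans ?_
  set Y : ℝ := 2 * Real.exp (-τ) * (G.powersetCard k).card with hY
  have hY0 : 0 ≤ Y := by positivity
  calc _ ≤ ∑ t ∈ Finset.range (K * d), (2 : ℝ) ^ t * Y := by
        refine Finset.sum_le_sum fun t ht => ?_
        refine (Finset.sum_le_sum fun p hp => hB t (Finset.mem_range.1 ht) p hp).trans ?_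
        rw [Finset.sum_const, nsmul_eq_mul]
        gcongr
        exact_mod_cast card_corners_le d K m t
    -- There are at most `2 ^ t` cells at level `t`, a geometric sum.
    _ ≤ 2 ^ (K * d) * Y := by
        rw [← Finset.sum_mul]
        gcongr
        have := Nat.geomSum_lt (m := 2) (n := K * d) (s := Finset.range (K * d)) le_rfl
          fun k hk => Finset.mem_range.1 hk
        exact_mod_cast this.le
    _ = _ := by rw [hY]; ring

/-! ### Counting and the uniform measure -/

noncomputable instance (d : ℕ) (N : ℤ) (k : ℕ) : Fintype (Feige.GridSubsets d N k) :=
  Fintype.subtype ((Feige.grid d N).powersetCard k) fun _ => Finset.mem_powersetCard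

instance (d : ℕ) (N : ℤ) (k : ℕ) : MeasurableSingletonClass (Feige.GridSubsets d N k) :=
  ⟨fun _ => trivial⟩

theorem card_gridSubsets (d : ℕ) (N : ℤ) (k : ℕ) :
    Fintype.card (Feige.GridSubsets d N k) = ((Feige.grid d N).powersetCard k).card :=
  Fintype.subtype_card _ fun _ => Finset.mem_powersetCard

theorem nonempty_gridSubsets {d : ℕ} {N : ℤ} {n : ℕ} (hN : n ≤ N) :
    Nonempty (Feige.GridSubsets d N (n ^ d)) :=
  ⟨⟨Feige.grid d n, Fintype.piFinset_subset _ _ fun _ => Finset.Icc_subset_Icc_right hN,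
    Feige.card_grid d n⟩⟩

theorem uniformOn_gridSubsets_le {d : ℕ} {N : ℤ} {k : ℕ} (P : Finset (Fin d → ℤ) → Prop)
    [DecidablePred P] {q : ℝ} (hq : 0 ≤ q)
    (h : ((((Feige.grid d N).powersetCard k).filter P).card : ℝ) ≤
      q * ((Feige.grid d N).powersetCard k).card) :
    uniformOn (Set.univ : Set (Feige.GridSubsets d N k)) {S | P S.1} ≤ ENNReal.ofReal q := by
  rw [uniformOn_univ, card_gridSubsets]
  refine ENNReal.div_le_of_le_mul ?_
  have hcount : Measure.count {S : Feige.GridSubsets d N k | P S.1} =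
      ((((Feige.grid d N).powersetCard k).filter P).card : ENNReal) := by
    rw [Measure.count_apply_finite _ (Set.toFinite _)]
    congr 1
    refine Finset.card_bij (fun S _ => S.1) ?_ (fun _ _ _ _ h => Subtype.ext h) ?_
    · intro S hS
      have h1 := (Set.Finite.mem_toFinset _).1 hS
      exact Finset.mem_filter.2 ⟨Finset.mem_powersetCard.2 S.2, h1⟩
    · intro S hS
      obtain ⟨h1, h2⟩ := Finset.mem_filter.1 hS
      exact ⟨⟨S, Finset.mem_powersetCard.1 h1⟩, (Set.Finite.mem_toFinset _).2 h2, rfl⟩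
  rw [hcount, ← ENNReal.ofReal_natCast, ← ENNReal.ofReal_natCast (Finset.card _),
    ← ENNReal.ofReal_mul hq]
  exact ENNReal.ofReal_le_ofReal h

/-! ### Choice of depth and tolerance -/

/-- The number of halvings per direction is as large as possible such that a cell still contains
about `C * (log n) ^ 3` points. -/
noncomputable def depth (d : ℕ) (C : ℝ) (n : ℕ) : ℕ :=
  open Classical in
  Nat.findGreatest (fun K => C * Real.logb 2 n ^ 3 * ((2 : ℝ) ^ K) ^ d ≤ (n : ℝ) ^ d) n

theorem one_le_logb_two {n : ℕ} (hn : 2 ≤ n) : 1 ≤ Real.logb 2 n := by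
  rw [Real.le_logb_iff_rpow_le (by norm_num) (by positivity), Real.rpow_one]
  exact_mod_cast hn

theorem logb_two_le {n : ℕ} (hn : 1 ≤ n) : Real.logb 2 n ≤ n := by
  rw [Real.logb_le_iff_le_rpow (by norm_num) (by positivity), Real.rpow_natCast]
  exact_mod_cast Nat.lt_two_pow_self.le

theorem log_le_logb_two {n : ℕ} (hn : 1 ≤ n) : Real.log n ≤ Real.logb 2 n := by
  rw [Real.logb, le_div_iff₀ (Real.log_pos (by norm_num))]
  have : Real.log 2 ≤ 1 := by linarith [Real.log_two_lt_d9]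
  exact mul_le_of_le_one_right (Real.log_nonneg (by exact_mod_cast hn)) this

theorem depth_spec {d : ℕ} {C : ℝ} {n : ℕ} (h : C * Real.logb 2 n ^ 3 ≤ (n : ℝ) ^ d) :
    C * Real.logb 2 n ^ 3 * ((2 : ℝ) ^ depth d C n) ^ d ≤ (n : ℝ) ^ d := by
  classical
  exact Nat.findGreatest_spec
    (P := fun K => C * Real.logb 2 n ^ 3 * ((2 : ℝ) ^ K) ^ d ≤ (n : ℝ) ^ d) (Nat.zero_le n)
    (by simpa using h)

/-- `Nat.findGreatest` defaults to `0` when no depth is admissible, which happens for small `n`. -/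
theorem depth_eq_zero {d : ℕ} {C : ℝ} {n : ℕ}
    (h : ¬ C * Real.logb 2 n ^ 3 * ((2 : ℝ) ^ depth d C n) ^ d ≤ (n : ℝ) ^ d) :
    depth d C n = 0 := by
  classical
  by_contra h0
  exact h (Nat.findGreatest_of_ne_zero
    (P := fun K => C * Real.logb 2 n ^ 3 * ((2 : ℝ) ^ K) ^ d ≤ (n : ℝ) ^ d) rfl h0)

theorem two_pow_depth_le {d : ℕ} {C : ℝ} {n : ℕ} (hd : 1 ≤ d) (hC : 1 ≤ C) (hn : 2 ≤ n)
    (h : C * Real.logb 2 n ^ 3 ≤ (n : ℝ) ^ d) : 2 ^ depth d C n ≤ n := by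
  have h1 : 1 ≤ C * Real.logb 2 n ^ 3 := one_le_mul_of_one_le_of_one_le hC
    (one_le_pow₀ (one_le_logb_two hn))
  have h2 : ((2 : ℝ) ^ depth d C n) ^ d ≤ (n : ℝ) ^ d :=
    (le_mul_of_one_le_left (by positivity) h1).trans (depth_spec h)
  exact_mod_cast (pow_le_pow_iff_left₀ (by positivity) (by positivity) (by omega)).1 h2

theorem lt_depth_succ {d : ℕ} {C : ℝ} {n : ℕ} (hd : 1 ≤ d) (hC : 1 ≤ C) (hn : 2 ≤ n)
    (h : C * Real.logb 2 n ^ 3 ≤ (n : ℝ) ^ d) :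
    (n : ℝ) ^ d < C * Real.logb 2 n ^ 3 * ((2 : ℝ) ^ (depth d C n + 1)) ^ d := by
  classical
  -- The search bound `n` is not attained, so `depth + 1` was tested and rejected.
  have hlt : depth d C n < n := Nat.lt_two_pow_self.trans_le (two_pow_depth_le hd hC hn h)
  exact not_le.1 (Nat.findGreatest_is_greatest
    (P := fun K => C * Real.logb 2 n ^ 3 * ((2 : ℝ) ^ K) ^ d ≤ (n : ℝ) ^ d)
    (Nat.lt_succ_self _) hlt)

theorem two_pow_depth_div_le {d : ℕ} {C : ℝ} {n : ℕ} (hd : 1 ≤ d) (hC : 1 ≤ C) (hn : 2 ≤ n) :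
    (2 : ℝ) ^ depth d C n / n ≤ 1 / Real.logb 2 n ^ ((1 : ℝ) / d) := by
  have hL := one_le_logb_two hn
  have hL0 : 0 < Real.logb 2 n := by linarith
  have hn0 : (0 : ℝ) < n := by positivity
  have hn1 : (1 : ℝ) ≤ n := by exact_mod_cast (by omega : 1 ≤ n)
  have hd0 : d ≠ 0 := by omega
  have key : Real.logb 2 n * ((2 : ℝ) ^ depth d C n) ^ d ≤ (n : ℝ) ^ d := by
    -- The rounding estimate is needed for every `n ≥ 2`; when no depth is admissible, `depth = 0`
    -- and `log n ≤ n` suffices.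
    by_cases h : C * Real.logb 2 n ^ 3 * ((2 : ℝ) ^ depth d C n) ^ d ≤ (n : ℝ) ^ d
    · refine le_trans ?_ h
      gcongr
      nlinarith [le_self_pow₀ hL (three_ne_zero), one_le_pow₀ hL (n := 3)]
    · rw [depth_eq_zero h]
      simp only [pow_zero, one_pow, mul_one]
      exact (logb_two_le (by omega)).trans (le_self_pow₀ hn1 hd0)
  rw [div_le_div_iff₀ hn0 (by positivity), one_mul]
  refine (pow_le_pow_iff_left₀ (by positivity) hn0.le hd0).1 ?_
  rw [mul_pow, ← Real.rpow_natCast (Real.logb 2 n ^ _), ← Real.rpow_mul hL0.le,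
    one_div_mul_cancel (by exact_mod_cast hd0), Real.rpow_one, mul_comm]
  exact key

theorem eventually_logb_pow_le {d : ℕ} (hd : 1 ≤ d) {C : ℝ} (hC : 0 < C) :
    ∀ᶠ n : ℕ in atTop, C * Real.logb 2 n ^ 3 ≤ (n : ℝ) ^ d := by
  have h2 : 0 < Real.log 2 := Real.log_pos (by norm_num)
  have h := ((Real.isLittleO_pow_log_id_atTop (n := 3)).bound
    (show 0 < Real.log 2 ^ 3 / C by positivity))
  filter_upwards [tendsto_natCast_atTop_atTop.eventually h, eventually_ge_atTop 1] with n hn hn1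
  have hn1' : (1 : ℝ) ≤ n := by exact_mod_cast hn1
  have hlog : 0 ≤ Real.log n := Real.log_nonneg hn1'
  rw [Real.norm_of_nonneg (by positivity), id, Real.norm_of_nonneg (by positivity)] at hn
  refine le_trans ?_ (le_self_pow₀ hn1' (by omega))
  rw [Real.logb, div_pow]
  calc C * (Real.log n ^ 3 / Real.log 2 ^ 3) ≤
        C * (Real.log 2 ^ 3 / C * n / Real.log 2 ^ 3) := by gcongr
    _ = (n : ℝ) := by field_simp

theorem div_two_pow_depth_mul_rpow_le {d : ℕ} {C : ℝ} {n : ℕ} {α : ℝ} (hd : 1 ≤ d) (hC : 1 ≤ C)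
    (hn : 2 ≤ n) (h : C * Real.logb 2 n ^ 3 ≤ (n : ℝ) ^ d) (hα : 3 < α) :
    (n : ℝ) / 2 ^ depth d C n * Real.logb 2 n ^ (-α / d) ≤ 2 ^ d * C := by
  have hL := one_le_logb_two hn
  have hL0 : 0 < Real.logb 2 n := by linarith
  have hd0 : d ≠ 0 := by omega
  have hB : 1 ≤ 2 ^ d * C := one_le_mul_of_one_le_of_one_le (one_le_pow₀ (by norm_num)) hC
  set x := (n : ℝ) / 2 ^ depth d C n * Real.logb 2 n ^ (-α / d) with hx
  have hxd : x ^ d ≤ 2 ^ d * C := by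
    have h1 : ((n : ℝ) / 2 ^ depth d C n) ^ d ≤ 2 ^ d * C * Real.logb 2 n ^ 3 := by
      rw [div_pow, div_le_iff₀ (by positivity)]
      refine (lt_depth_succ hd hC hn h).le.trans (le_of_eq ?_)
      rw [pow_succ (2 : ℝ), mul_pow]
      ring
    have h2 : (Real.logb 2 n ^ (-α / d)) ^ d = Real.logb 2 n ^ (-α) := by
      rw [← Real.rpow_natCast, ← Real.rpow_mul hL0.le,
        div_mul_cancel₀ _ (by exact_mod_cast hd0)]
    have h3 : Real.logb 2 n ^ 3 * Real.logb 2 n ^ (-α) ≤ 1 := by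
      rw [← Real.rpow_natCast, ← Real.rpow_add hL0]
      refine Real.rpow_le_one_of_one_le_of_nonpos hL ?_
      push_cast
      linarith
    rw [hx, mul_pow, h2]
    calc _ ≤ 2 ^ d * C * Real.logb 2 n ^ 3 * Real.logb 2 n ^ (-α) := by gcongr
      _ = 2 ^ d * C * (Real.logb 2 n ^ 3 * Real.logb 2 n ^ (-α)) := by ring
      _ ≤ _ := mul_le_of_le_one_right (by positivity) h3
  -- The bound on `x ^ d` passes to `x` only when `x ≥ 1`.
  rcases le_total x 1 with h1 | h1
  · exact h1.trans hB
  · exact (le_self_pow₀ h1 hd0).trans hxd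

/-- The average number of points in a cell, up to the factor `(log n) ^ 3`. -/
noncomputable def cellConst (d : ℕ) : ℝ := 2 ^ d * (16 * d ^ 2 * (d + 2))

theorem one_le_cellConst {d : ℕ} (hd : 1 ≤ d) : 1 ≤ cellConst d := by
  have : (1 : ℝ) ≤ d := by exact_mod_cast hd
  unfold cellConst
  refine one_le_mul_of_one_le_of_one_le (one_le_pow₀ (by norm_num)) ?_
  nlinarith [one_le_pow₀ this (n := 2)]

/-- The tolerance for the relative imbalance of the cuts. -/
noncomputable def tolerance (d n : ℕ) : ℝ := 1 / (2 * d * Real.logb 2 n)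

theorem depth_mul_tolerance_le {d n : ℕ} (hd : 1 ≤ d) (hn : 2 ≤ n)
    (h : cellConst d * Real.logb 2 n ^ 3 ≤ (n : ℝ) ^ d) :
    depth d (cellConst d) n * d * tolerance d n ≤ 1 / 2 := by
  have hL := one_le_logb_two hn
  have hL0 : 0 < Real.logb 2 n := by linarith
  have hd0 : (0 : ℝ) < d := by exact_mod_cast hd
  have hK : (depth d (cellConst d) n : ℝ) ≤ Real.logb 2 n := by
    rw [Real.le_logb_iff_rpow_le (by norm_num) (by positivity), Real.rpow_natCast]
    exact_mod_cast two_pow_depth_le hd (one_le_cellConst hd) hn h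
  rw [tolerance, mul_one_div, div_le_div_iff₀ (by positivity) (by norm_num)]
  nlinarith [mul_le_mul_of_nonneg_right hK hd0.le]

/-- `cellConst` is chosen to make this balance exact: the squared tolerance cancels `4 * d ^ 2` and
two of the three logarithms, leaving `4 * (d + 2) * log n`. -/
theorem log_le_tolerance_sq_mul {d n : ℕ} (hd : 1 ≤ d) (hn : 2 ≤ n)
    (h : cellConst d * Real.logb 2 n ^ 3 ≤ (n : ℝ) ^ d) :
    4 * ((d + 2) * Real.log n) ≤
      tolerance d n ^ 2 * ((n : ℝ) / 2 ^ depth d (cellConst d) n / 2) ^ d := by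
  have hL := one_le_logb_two hn
  have hL0 : 0 < Real.logb 2 n := by linarith
  have hd0 : (0 : ℝ) < d := by exact_mod_cast hd
  have h1 : cellConst d * Real.logb 2 n ^ 3 ≤ ((n : ℝ) / 2 ^ depth d (cellConst d) n) ^ d := by
    rw [div_pow, le_div_iff₀ (by positivity)]
    exact depth_spec h
  calc 4 * ((d + 2) * Real.log n) ≤ 4 * ((d + 2) * Real.logb 2 n) := by
        gcongr
        exact log_le_logb_two (by omega)
    _ = tolerance d n ^ 2 * (cellConst d * Real.logb 2 n ^ 3 / 2 ^ d) := by
        rw [tolerance, cellConst]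
        field_simp
        ring
    _ ≤ _ := by
        rw [div_pow _ (2 : ℝ)]
        gcongr

/-- Of the exponent `d + 2`, the part `d` pays for the at most `n ^ d` cells and `2` leaves a
summable bound. -/
theorem two_mul_two_pow_mul_exp_le {d n K : ℕ} (hn : 1 ≤ n) (hK : 2 ^ K ≤ n) :
    2 * 2 ^ (K * d) * Real.exp (-((d + 2) * Real.log n)) ≤ 2 * (1 / (n : ℝ) ^ 2) := by
  have hn0 : (0 : ℝ) < n := by exact_mod_cast hn
  have h1 : (2 : ℝ) ^ (K * d) ≤ (n : ℝ) ^ d := by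
    rw [pow_mul]
    gcongr
    exact_mod_cast hK
  have h2 : Real.exp (-((d + 2) * Real.log n)) = 1 / ((n : ℝ) ^ d * (n : ℝ) ^ 2) := by
    rw [Real.exp_neg, ← pow_add, one_div, mul_comm, Real.exp_mul, Real.exp_log hn0,
      ← Real.rpow_natCast]
    push_cast
    rfl
  rw [h2, mul_assoc]
  gcongr
  rw [mul_one_div, div_le_div_iff₀ (by positivity) (by positivity), one_mul]
  gcongr

theorem uniformOn_not_isBalanced_le {d : ℕ} [NeZero d] (hd : 2 ≤ d) (n m : ℕ) (hn : 2 ≤ n)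
    (h : cellConst d * Real.logb 2 n ^ 3 ≤ (n : ℝ) ^ d) :
    uniformOn (Set.univ : Set (Feige.GridSubsets d (m * 2 ^ depth d (cellConst d) n : ℕ) (n ^ d)))
      {S | ¬ IsBalanced d (depth d (cellConst d) n) m n (tolerance d n) S.1} ≤
    ENNReal.ofReal (2 * (1 / (n : ℝ) ^ 2)) := by
  classical
  have hd1 : 1 ≤ d := by omega
  have hL := one_le_logb_two hn
  have hd0 : (0 : ℝ) < d := by exact_mod_cast hd1
  have htol : 0 < tolerance d n := by
    rw [tolerance]; positivity
  refine (uniformOn_gridSubsets_le (fun S => ¬ IsBalanced d (depth d (cellConst d) n) m n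
    (tolerance d n) S) (by positivity) (card_filter_not_isBalanced_le hd htol _
      (log_le_tolerance_sq_mul hd1 hn h))).trans (ENNReal.ofReal_le_ofReal ?_)
  exact two_mul_two_pow_mul_exp_le (by omega) (two_pow_depth_le hd1 (one_le_cellConst hd1) hn h)

/-! ### Rounding the ratios, Borel–Cantelli and the conclusion -/

/-- The side length, in units of `2 ^ depth`, of the smallest admissible cube of side at least
`e * n`. -/
noncomputable def cellWidth (d : ℕ) (e : ℕ+ → ℝ) (n : ℕ+) : ℕ :=
  ⌈e n * (n : ℕ) / 2 ^ depth d (cellConst d) n⌉₊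

/-- The rounding of `e` to ratios admitting exact halvings. -/
noncomputable def roundedRatio (d : ℕ) (e : ℕ+ → ℝ) (n : ℕ+) : ℝ :=
  ((cellWidth d e n * 2 ^ depth d (cellConst d) n : ℕ) : ℝ) / (n : ℕ)

theorem le_roundedRatio (d : ℕ) (e : ℕ+ → ℝ) (n : ℕ+) : e n ≤ roundedRatio d e n := by
  have hn : (0 : ℝ) < (n : ℕ) := by exact_mod_cast n.pos
  rw [roundedRatio, le_div_iff₀ hn]
  push_cast
  rw [← div_le_iff₀ (by positivity)]
  exact Nat.le_ceil _

theorem roundedRatio_sub_le (d : ℕ) (e : ℕ+ → ℝ) (n : ℕ+) (he : 0 ≤ e n) :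
    roundedRatio d e n - e n ≤ 2 ^ depth d (cellConst d) n / (n : ℕ) := by
  have hn : (0 : ℝ) < (n : ℕ) := by exact_mod_cast n.pos
  rw [sub_le_iff_le_add, roundedRatio, div_le_iff₀ hn, add_mul, div_mul_cancel₀ _ hn.ne']
  have := (Nat.ceil_lt_add_one
    (show 0 ≤ e n * (n : ℕ) / 2 ^ depth d (cellConst d) n by positivity)).le
  push_cast
  calc _ ≤ (e n * (n : ℕ) / 2 ^ depth d (cellConst d) n + 1) * 2 ^ depth d (cellConst d) n := by
        gcongr
        exact this
    _ = _ := by field_simp; ring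

theorem floor_roundedRatio_mul (d : ℕ) (e : ℕ+ → ℝ) (n : ℕ+) :
    ⌊roundedRatio d e n * (n : ℕ)⌋ =
      ((cellWidth d e n * 2 ^ depth d (cellConst d) n : ℕ) : ℤ) := by
  have hn : (0 : ℝ) < (n : ℕ) := by exact_mod_cast n.pos
  rw [roundedRatio, div_mul_cancel₀ _ hn.ne', Int.floor_natCast]

theorem le_cellWidth_mul (d : ℕ) (e : ℕ+ → ℝ) (n : ℕ+) (he : 1 ≤ e n) :
    (n : ℕ) ≤ cellWidth d e n * 2 ^ depth d (cellConst d) n := by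
  have hn : (0 : ℝ) < (n : ℕ) := by exact_mod_cast n.pos
  have := he.trans (le_roundedRatio d e n)
  rw [roundedRatio, one_le_div hn] at this
  exact_mod_cast this

/-- Almost surely, all but finitely many terms of a random sequence are balanced. -/
theorem ae_eventually_isBalanced {d : ℕ} [NeZero d] (hd : 2 ≤ d) (e : ℕ+ → ℝ)
    (he : ∀ n, 1 ≤ e n) :
    ∀ᵐ S ∂Feige.uniformSeq d (roundedRatio d e), ∀ᶠ n : ℕ+ in atTop,
      IsBalanced d (depth d (cellConst d) n) (cellWidth d e n) n (tolerance d n) (S n).1 := by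
  have hd1 : 1 ≤ d := by omega
  have : ∀ n : ℕ+, Nonempty
      (Feige.GridSubsets d ⌊roundedRatio d e n * (n : ℕ)⌋ ((n : ℕ) ^ d)) := fun n => by
    rw [floor_roundedRatio_mul]
    exact nonempty_gridSubsets (by exact_mod_cast le_cellWidth_mul d e n (he n))
  let cond : ℕ → Prop := fun n => 2 ≤ n ∧ cellConst d * Real.logb 2 n ^ 3 ≤ (n : ℝ) ^ d
  -- Including `cond n` makes the event empty for small `n`, so the bound `2 / n ^ 2` holds for
  -- every `n`.
  let bad : ∀ n : ℕ+, Set (Feige.GridSubsets d ⌊roundedRatio d e n * (n : ℕ)⌋ ((n : ℕ) ^ d)) :=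
    fun n => {S | cond n ∧
      ¬ IsBalanced d (depth d (cellConst d) n) (cellWidth d e n) n (tolerance d n) S.1}
  have hbad : ∀ n, uniformOn Set.univ (bad n) ≤
      ENNReal.ofReal (2 * (1 / ((n : ℕ) : ℝ) ^ 2)) := by
    intro n
    by_cases hc : cond n
    · refine (measure_mono fun S hS => hS.2).trans ?_
      rw [floor_roundedRatio_mul]
      exact uniformOn_not_isBalanced_le hd n _ hc.1 hc.2
    · have : bad n = ∅ := Set.eq_empty_of_forall_notMem fun S hS => hc hS.1
      simp [this]
  have hsum : ∑' n : ℕ+, Feige.uniformSeq d (roundedRatio d e) (Function.eval n ⁻¹' bad n) ≠ ⊤ := by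
    have hs : Summable fun n : ℕ+ => 2 * (1 / ((n : ℕ) : ℝ) ^ 2) :=
      ((Real.summable_one_div_nat_pow.2 one_lt_two).comp_injective PNat.coe_injective).mul_left 2
    refine ne_top_of_le_ne_top hs.tsum_ofReal_ne_top (ENNReal.tsum_le_tsum fun n => ?_)
    -- Only the marginal laws enter: the convergence half of Borel–Cantelli needs no independence.
    rw [Feige.uniformSeq, (measurePreserving_eval_infinitePi (fun n : ℕ+ => uniformOn
      (Set.univ : Set (Feige.GridSubsets d ⌊roundedRatio d e n * (n : ℕ)⌋ ((n : ℕ) ^ d)))) n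
      ).measure_preimage (show MeasurableSet (bad n) from trivial).nullMeasurableSet]
    exact hbad n
  have hcond : ∀ᶠ n : ℕ+ in atTop, cond n :=
    tendsto_PNat_val_atTop_atTop.eventually ((eventually_ge_atTop 2).and
      (eventually_logb_pow_le hd1 (zero_lt_one.trans_le (one_le_cellConst hd1))))
  filter_upwards [ae_finite_setOfPred_mem hsum] with S hS
  filter_upwards [hcond, atTop_le_cofinite hS.compl_mem_cofinite] with n hn hn'
  by_contra hb
  exact hn' ⟨hn, hb⟩

theorem theorem2 (d : ℕ) (hd : 2 ≤ d) (e : ℕ+ → ℝ) (he : ∀ n, 1 ≤ e n) :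
    ∃ c : ℕ+ → ℝ,
      (∀ n, 1 ≤ c n) ∧
      (∀ n : ℕ+, 2 ≤ n →
        |c n - e n| ≤ 2 ^ (d + 8) / (Real.logb 2 (n : ℕ)) ^ ((1 : ℝ) / d)) ∧
      ∀ α : ℝ, 3 < α →
        Feige.uniformSeq d c
          {S : Feige.SeqSpace d c |
            limsup (fun n : ℕ+ =>
              ((Feige.feige d n (S n).1 * (Real.logb 2 (n : ℕ)) ^ (-α / d) : ℝ) : EReal))
              atTop < ⊤} = 1 := by
  have : NeZero d := ⟨by omega⟩
  have hd1 : 1 ≤ d := by omega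
  have hC := one_le_cellConst hd1
  refine ⟨roundedRatio d e, fun n => (he n).trans (le_roundedRatio d e n), fun n hn => ?_,
    fun α hα => ?_⟩
  · have hn' : 2 ≤ (n : ℕ) := hn
    have hL := one_le_logb_two hn'
    rw [abs_of_nonneg (sub_nonneg.2 (le_roundedRatio d e n))]
    refine (roundedRatio_sub_le d e n (zero_le_one.trans (he n))).trans
      ((two_pow_depth_div_le hd1 hC hn').trans ?_)
    gcongr
    exact one_le_pow₀ (by norm_num)
  have : ∀ n : ℕ+, Nonempty
      (Feige.GridSubsets d ⌊roundedRatio d e n * (n : ℕ)⌋ ((n : ℕ) ^ d)) := fun n => by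
    rw [floor_roundedRatio_mul]
    exact nonempty_gridSubsets (by exact_mod_cast le_cellWidth_mul d e n (he n))
  have : IsProbabilityMeasure (Feige.uniformSeq d (roundedRatio d e)) := by
    unfold Feige.uniformSeq
    infer_instance
  have hae : ∀ᵐ S ∂Feige.uniformSeq d (roundedRatio d e), limsup (fun n : ℕ+ =>
      ((Feige.feige d n (S n).1 * (Real.logb 2 (n : ℕ)) ^ (-α / d) : ℝ) : EReal)) atTop < ⊤ := by
    filter_upwards [ae_eventually_isBalanced hd e he] with S hS
    refine lt_of_le_of_lt (limsup_le_of_le (by isBoundedDefault)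
      (a := ((7 * d * (2 ^ d * cellConst d) : ℝ) : EReal)) ?_) (EReal.coe_lt_top _)
    filter_upwards [hS, tendsto_PNat_val_atTop_atTop.eventually ((eventually_ge_atTop 2).and
      (eventually_logb_pow_le hd1 (zero_lt_one.trans_le hC)))] with n hbal hn
    obtain ⟨hn2, hn3⟩ := hn
    have hL := one_le_logb_two hn2
    rw [EReal.coe_le_coe_iff]
    have hsub := (S n).2.1.trans
      (congrArg (Feige.grid d) (floor_roundedRatio_mul d e n)).subset
    have hF := feige_le_of_isBalanced (two_pow_depth_le hd1 hC hn2 hn3)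
      (le_cellWidth_mul d e n (he n)) (by rw [tolerance]; positivity)
      (depth_mul_tolerance_le hd1 hn2 hn3) hsub (S n).2.2 hbal
    calc _ ≤ 7 * d * ((n : ℕ) / 2 ^ depth d (cellConst d) n) *
          Real.logb 2 (n : ℕ) ^ (-α / d) := by gcongr
      _ = 7 * d * ((n : ℕ) / 2 ^ depth d (cellConst d) n *
          Real.logb 2 (n : ℕ) ^ (-α / d)) := by ring
      _ ≤ _ := mul_le_mul_of_nonneg_left
        (div_two_pow_depth_mul_rpow_le hd1 hC hn2 hn3 hα) (by positivity)
  -- The event is almost everywhere equal to the whole space, so its measurability need not be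
  -- shown.
  rw [← measure_univ (μ := Feige.uniformSeq d (roundedRatio d e))]
  refine measure_congr ?_
  filter_upwards [hae] with S hS
  exact propext ⟨fun _ => trivial, fun _ => hS⟩
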